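/- Let $R$ be a commutative ring with $1$, let $\mathscr A$ be a non-empty set (of any cardinality), and let $X\subseteq\mathscr A^{\mathbb N}$ be a subshift, i.e. for some set $F$ of finite words (possibly containing the empty word $\omega$), $X$ is the set of all sequences none of whose finite blocks lies in $F$. Let $\mathcal L_X$ be the set of finite words (including $\omega$) that are blocks of elements of $X$, and assume that every letter $a\in\mathscr A$ belongs to $\mathcal L_X$. For $\alpha,\beta\in\mathcal L_X$ put $C(\alpha,\beta)=\{\beta x\in X:\alpha x\in X\}$. Let $\mathcal U$ be the Boolean algebra of subsets of $X$ (with greatest element $X=C(\omega,\omega)$) generated by all $C(\alpha,\beta)$, $\alpha,\beta\in\mathcal L_X$, and let $\mathcal B$ be the Boolean algebra of subsets of $X$ (containing $\emptyset$ and closed under finite unions, finite intersections and relative complements, but not necessarily containing $X$) generated by all $C(\alpha,\beta)$ with $\alpha,\beta\in\mathcal L_X$ not both equal to $\omega$. For $\alpha=\alpha_1\cdots\alpha_n$ write $s_\alpha=s_{\alpha_1}\cdots s_{\alpha_n}$ and $s_\alpha^*=s_{\alpha_n}^*\cdots s_{\alpha_1}^*$. The unital subshift algebra $\widetilde{\mathcal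 A}_R(X)$ is the universal unital (associative) $R$-algebra with generators $p_A$ ($A\in\mathcal U$) and $s_a,s_a^*$ ($a\in\mathscr A$) subject to: (i) $p_X=1$, $p_\emptyset=0$, $p_{A\cap B}=p_Ap_B$ and $p_{A\cup B}=p_A+p_B-p_{A\cap B}$ for $A,B\in\mathcal U$; (ii) $s_as_a^*s_a=s_a$ and $s_a^*s_as_a^*=s_a^*$ for $a\in\mathscr A$; (iii) $s_\beta s_\alpha^*s_\alpha s_\beta^*=p_{C(\alpha,\beta)}$ for $\alpha,\beta\in\mathcal L_X$, where $s_\omega=s_\omega^*=1$. The subshift algebra $\mathcal A_R(X)$ is the universal (not necessarily unital, associative) $R$-algebra with generators $p_A$ ($A\in\mathcal B$) and $s_a,s_a^*$ ($a\in\mathscr A$) subject to: (i) $p_\emptyset=0$, $p_{A\cap B}=p_Ap_B$ and $p_{A\cup B}=p_A+p_B-p_{A\cap B}$ for $A,B\in\mathcal B$; (ii) $s_as_a^*s_a=s_a$ and $s_a^*s_as_a^*=s_a^*$ for $a\in\mathscr A$; (iii) $s_\beta s_\alpha^*s_\alpha s_\beta^*=p_{C(\alpha,\beta)}$, $s_\alpha^*s_\alpha=p_{C(\alpha,\omega)}$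 and $s_\beta s_\beta^*=p_{C(\omega,\beta)}$ for $\alpha,\beta\in\mathcal L_X\setminus\{\omega\}$. Then: 1. If $\mathcal A_R(X)$ is unital (has a two-sided identity element), then $\mathcal A_R(X)\cong\widetilde{\mathcal A}_R(X)$ as $R$-algebras. 2. If $\mathcal A_R(X)$ is not unital, then its unitization is isomorphic to $\widetilde{\mathcal A}_R(X)$ as an $R$-algebra, where the unitization is $\mathcal A_R(X)\oplus R$ with coordinatewise addition and scalar multiplication and with product $(a,r)(b,s)=(ab+sa+rb,rs)$. -/

import Mathlib

noncomputable section

namespace SubshiftAlgebra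

universe u v w

/-! ### Subshifts over an arbitrary alphabet -/

section Symbolic

variable {𝒜 : Type v}

/-- The finite word `w` is a block of the one-sided infinite sequence `x`
(the empty word is a block of every sequence). -/
def IsBlockOf (w : List 𝒜) (x : Stream' 𝒜) : Prop :=
  ∃ i : ℕ, (x.drop i).take w.length = w

/-- `X` is the subshift `X_F` of all sequences without blocks in `F`, for some set `F` of
finite words. -/
def IsSubshift (X : Set (Stream' 𝒜)) : Prop :=
  ∃ F : Set (List 𝒜), X = {x | ∀ w ∈ F, ¬ IsBlockOf w x}

/-- The language of `X`: the finite words that are initial blocks of sequences in `X`. -/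
def language (X : Set (Stream' 𝒜)) : Set (List 𝒜) :=
  {w | ∃ x ∈ X, x.take w.length = w}

/-- `C(α, β) = {β x ∈ X : α x ∈ X}`, as a subset of `X`. -/
def C (X : Set (Stream' 𝒜)) (α β : List 𝒜) : Set X :=
  {y | ∃ x : Stream' 𝒜,
    (y : Stream' 𝒜) = Stream'.appendStream' β x ∧ Stream'.appendStream' α x ∈ X}

/-- The Boolean algebra of sets (relatively complemented, with least element `∅`, not necessarily
with a greatest element) generated by a family `𝒢` of sets. -/
inductive generateSetRing {S : Type v} (𝒢 : Set (Set S)) : Set (Set S)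
  | base (A : Set S) (hA : A ∈ 𝒢) : generateSetRing 𝒢 A
  | empty : generateSetRing 𝒢 ∅
  | union (A B : Set S) (hA : generateSetRing 𝒢 A) (hB : generateSetRing 𝒢 B) :
      generateSetRing 𝒢 (A ∪ B)
  | inter (A B : Set S) (hA : generateSetRing 𝒢 A) (hB : generateSetRing 𝒢 B) :
      generateSetRing 𝒢 (A ∩ B)
  | diff (A B : Set S) (hA : generateSetRing 𝒢 A) (hB : generateSetRing 𝒢 B) :
      generateSetRing 𝒢 (A \ B)

/-- `𝓤`: the Boolean algebra of subsets of `X`, with greatest element `X`, generated by all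
`C(α, β)` with `α, β` in the language. -/
def U (X : Set (Stream' 𝒜)) : Set (Set X) :=
  MeasureTheory.generateSetAlgebra
    {A | ∃ α ∈ language X, ∃ β ∈ language X, A = C X α β}

/-- `𝓑`: the Boolean algebra of subsets of `X` generated by all `C(α, β)` with `α, β` in the
language and not both empty. -/
def B (X : Set (Stream' 𝒜)) : Set (Set X) :=
  generateSetRing
    {A | ∃ α ∈ language X, ∃ β ∈ language X, ¬ (α = [] ∧ β = []) ∧ A = C X α β}

theorem C_mem_U {X : Set (Stream' 𝒜)} {α β : List 𝒜} (hα : α ∈ language X)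
    (hβ : β ∈ language X) : C X α β ∈ U X :=
  MeasureTheory.generateSetAlgebra.base _ ⟨α, hα, β, hβ, rfl⟩

theorem empty_mem_U (X : Set (Stream' 𝒜)) : ∅ ∈ U X :=
  MeasureTheory.isSetAlgebra_generateSetAlgebra.empty_mem

theorem univ_mem_U (X : Set (Stream' 𝒜)) : Set.univ ∈ U X :=
  MeasureTheory.isSetAlgebra_generateSetAlgebra.univ_mem

theorem union_mem_U {X : Set (Stream' 𝒜)} {P Q : Set X} (hP : P ∈ U X) (hQ : Q ∈ U X) :
    P ∪ Q ∈ U X :=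
  MeasureTheory.isSetAlgebra_generateSetAlgebra.union_mem hP hQ

theorem inter_mem_U {X : Set (Stream' 𝒜)} {P Q : Set X} (hP : P ∈ U X) (hQ : Q ∈ U X) :
    P ∩ Q ∈ U X :=
  MeasureTheory.isSetAlgebra_generateSetAlgebra.inter_mem hP hQ

theorem C_mem_B {X : Set (Stream' 𝒜)} {α β : List 𝒜} (hα : α ∈ language X)
    (hβ : β ∈ language X) (h : ¬ (α = [] ∧ β = [])) : C X α β ∈ B X :=
  generateSetRing.base _ ⟨α, hα, β, hβ, h, rfl⟩

theorem empty_mem_B (X : Set (Stream' 𝒜)) : ∅ ∈ B X :=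
  generateSetRing.empty

theorem union_mem_B {X : Set (Stream' 𝒜)} {P Q : Set X} (hP : P ∈ B X) (hQ : Q ∈ B X) :
    P ∪ Q ∈ B X :=
  generateSetRing.union _ _ hP hQ

theorem inter_mem_B {X : Set (Stream' 𝒜)} {P Q : Set X} (hP : P ∈ B X) (hQ : Q ∈ B X) :
    P ∩ Q ∈ B X :=
  generateSetRing.inter _ _ hP hQ

theorem nil_mem_language {X : Set (Stream' 𝒜)} {α : List 𝒜} (hα : α ∈ language X) :
    [] ∈ language X :=
  let ⟨x, hx, _⟩ := hα
  ⟨x, hx, rfl⟩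

/-- The generators: `p A` for `A` in a family `𝒮` of sets, and `s a`, `t a` (standing for
`s_a`, `s_a^*`) for `a` in the alphabet. -/
inductive Gen (𝒜 : Type v) {S : Type v} (𝒮 : Set (Set S)) : Type v
  | p (A : 𝒮) : Gen 𝒜 𝒮
  | s (a : 𝒜) : Gen 𝒜 𝒮
  | t (a : 𝒜) : Gen 𝒜 𝒮

end Symbolic

/-! ### The unital subshift algebra -/

section Unital

variable (R : Type u) [CommRing R] {𝒜 : Type v} (X : Set (Stream' 𝒜))

/-- The free unital `R`-algebra on the generators `p A`, `s a`, `s_a^*`, with `A ∈ 𝓤`. -/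
abbrev UFree : Type (max u v) := FreeAlgebra R (Gen 𝒜 (U X))

namespace UFree

variable {X}

/-- The generator `p_A`. -/
def p (A : Set X) (hA : A ∈ U X) : UFree R X := FreeAlgebra.ι R (Gen.p ⟨A, hA⟩)

variable (X)

/-- The generator `s_a`. -/
def s (a : 𝒜) : UFree R X := FreeAlgebra.ι R (Gen.s a)

/-- The generator `s_a^*`. -/
def t (a : 𝒜) : UFree R X := FreeAlgebra.ι R (Gen.t a)

/-- `s_α = s_{α₁} ⋯ s_{αₙ}`, with `s_ω = 1`. -/
def sWord : List 𝒜 → UFree R X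
  | [] => 1
  | a :: α => s R X a * sWord α

/-- `s_α^* = s_{αₙ}^* ⋯ s_{α₁}^*`, with `s_ω^* = 1`. -/
def tWord : List 𝒜 → UFree R X
  | [] => 1
  | a :: α => tWord α * t R X a

end UFree

open UFree in
/-- The defining relations of the unital subshift algebra. -/
inductive URel : UFree R X → UFree R X → Prop
  | univ : URel (p R Set.univ (univ_mem_U X)) 1
  | inter (P Q : Set X) (hP : P ∈ U X) (hQ : Q ∈ U X) :
      URel (p R (P ∩ Q) (inter_mem_U hP hQ)) (p R P hP * p R Q hQ)
  | union (P Q : Set X) (hP : P ∈ U X) (hQ : Q ∈ U X) :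
      URel (p R (P ∪ Q) (union_mem_U hP hQ))
        (p R P hP + p R Q hQ - p R (P ∩ Q) (inter_mem_U hP hQ))
  | empty : URel (p R ∅ (empty_mem_U X)) 0
  | sts (a : 𝒜) : URel (s R X a * t R X a * s R X a) (s R X a)
  | tst (a : 𝒜) : URel (t R X a * s R X a * t R X a) (t R X a)
  | word (α β : List 𝒜) (hα : α ∈ language X) (hβ : β ∈ language X) :
      URel (sWord R X β * tWord R X α * sWord R X α * tWord R X β)
        (p R (C X α β) (C_mem_U hα hβ))

/-- The unital subshift algebra `Ã_R(X)`: the universal unital `R`-algebra with the above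
generators and relations. -/
def UnitalAlgebra : Type (max u v) := RingQuot (URel R X)

instance : Ring (UnitalAlgebra R X) := inferInstanceAs (Ring (RingQuot (URel R X)))

instance : Algebra R (UnitalAlgebra R X) := inferInstanceAs (Algebra R (RingQuot (URel R X)))

end Unital

/-! ### Non-unital associative algebras given by generators and relations -/

section Presented

variable (R : Type u) [CommRing R] {G : Type w}

/-- The free (non-unital, associative) `R`-algebra on `G`: the semigroup algebra of the free
semigroup on `G`. -/
abbrev NFree (R : Type u) [CommRing R] (G : Type w) : Type (max u w) :=
  MonoidAlgebra R (FreeSemigroup G)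

/-- A generator of the free non-unital algebra. -/
def NFree.ι (g : G) : NFree R G := MonoidAlgebra.single (FreeSemigroup.of g) 1

variable {R}

/-- The smallest congruence of `R`-algebras containing `rel`. The scalar multiples of the relations
are included because a ring congruence of a non-unital algebra need not respect scalars. -/
def presentedCon (rel : NFree R G → NFree R G → Prop) : RingCon (NFree R G) :=
  ringConGen fun x y => ∃ (r : R) (a b : NFree R G), rel a b ∧ x = r • a ∧ y = r • b

theorem presentedCon_smul (rel : NFree R G → NFree R G → Prop) (r : R) {x y : NFree R G}
    (h : presentedCon rel x y) : presentedCon rel (r • x) (r • y) := by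
  change RingConGen.Rel _ x y at h
  induction h with
  | of x y h =>
    obtain ⟨r', a, b, hab, rfl, rfl⟩ := h
    exact RingConGen.Rel.of _ _ ⟨r * r', a, b, hab, smul_smul _ _ _, smul_smul _ _ _⟩
  | refl x => exact (presentedCon rel).refl _
  | symm _ ih => exact (presentedCon rel).symm ih
  | trans _ _ ih₁ ih₂ => exact (presentedCon rel).trans ih₁ ih₂
  | add _ _ ih₁ ih₂ =>
    rw [smul_add, smul_add]
    exact (presentedCon rel).add ih₁ ih₂
  | @mul w x y z _ h₂ ih₁ _ =>
    rw [← smul_mul_assoc, ← smul_mul_assoc]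
    exact (presentedCon rel).mul ih₁ h₂

/-- The universal (not necessarily unital) `R`-algebra on `G` subject to the relations `rel`. -/
def Presented (rel : NFree R G → NFree R G → Prop) : Type (max u w) :=
  (presentedCon rel).Quotient

namespace Presented

variable (rel : NFree R G → NFree R G → Prop)

instance : NonUnitalRing (Presented rel) :=
  inferInstanceAs (NonUnitalRing (presentedCon rel).Quotient)

/-- The quotient map. -/
def mk (x : NFree R G) : Presented rel := (x : (presentedCon rel).Quotient)

instance : SMul R (Presented rel) where
  smul r := Quotient.map' (fun x => r • x) fun _ _ h => presentedCon_smul rel r h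

theorem mk_surjective : Function.Surjective (mk rel) := Quotient.mk''_surjective

theorem smul_mk (r : R) (x : NFree R G) : r • mk rel x = mk rel (r • x) := rfl

theorem mk_add (x y : NFree R G) : mk rel (x + y) = mk rel x + mk rel y := rfl

theorem mk_mul (x y : NFree R G) : mk rel (x * y) = mk rel x * mk rel y := rfl

instance : Module R (Presented rel) :=
  Function.Surjective.module R
    ({ toFun := mk rel, map_zero' := rfl, map_add' := mk_add rel } : NFree R G →+ Presented rel)
    (mk_surjective rel) fun _ _ => rfl

instance : IsScalarTower R (Presented rel) (Presented rel) where
  smul_assoc r x y := by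
    obtain ⟨x, rfl⟩ := mk_surjective rel x
    obtain ⟨y, rfl⟩ := mk_surjective rel y
    simp only [smul_eq_mul, smul_mk, ← mk_mul, smul_mul_assoc]

instance : SMulCommClass R (Presented rel) (Presented rel) where
  smul_comm r x y := by
    obtain ⟨x, rfl⟩ := mk_surjective rel x
    obtain ⟨y, rfl⟩ := mk_surjective rel y
    simp only [smul_eq_mul, smul_mk, ← mk_mul, mul_smul_comm]

end Presented

end Presented

/-! ### The subshift algebra -/

section NonUnital

variable (R : Type u) [CommRing R] {𝒜 : Type v} (X : Set (Stream' 𝒜))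

/-- The free non-unital `R`-algebra on the generators `p A`, `s a`, `s_a^*`, with `A ∈ 𝓑`. -/
abbrev BFree : Type (max u v) := NFree R (Gen 𝒜 (B X))

namespace BFree

variable {X}

/-- The generator `p_A`. -/
def p (A : Set X) (hA : A ∈ B X) : BFree R X := NFree.ι R (Gen.p ⟨A, hA⟩)

variable (X)

/-- The generator `s_a`. -/
def s (a : 𝒜) : BFree R X := NFree.ι R (Gen.s a)

/-- The generator `s_a^*`. -/
def t (a : 𝒜) : BFree R X := NFree.ι R (Gen.t a)

/-- `sWord a α = s_{aα} = s_a s_{α₁} ⋯ s_{αₙ}`, for the nonempty word `aα`. -/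
def sWord : 𝒜 → List 𝒜 → BFree R X
  | a, [] => s R X a
  | a, b :: α => s R X a * sWord b α

/-- `tWord a α = s_{aα}^* = s_{αₙ}^* ⋯ s_{α₁}^* s_a^*`, for the nonempty word `aα`. -/
def tWord : 𝒜 → List 𝒜 → BFree R X
  | a, [] => t R X a
  | a, b :: α => tWord b α * t R X a

end BFree

open BFree in
/-- The defining relations of the subshift algebra; the nonempty words in the language are
written as `a :: α` and `b :: β`. -/
inductive BRel : BFree R X → BFree R X → Prop
  | inter (P Q : Set X) (hP : P ∈ B X) (hQ : Q ∈ B X) :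
      BRel (p R (P ∩ Q) (inter_mem_B hP hQ)) (p R P hP * p R Q hQ)
  | union (P Q : Set X) (hP : P ∈ B X) (hQ : Q ∈ B X) :
      BRel (p R (P ∪ Q) (union_mem_B hP hQ))
        (p R P hP + p R Q hQ - p R (P ∩ Q) (inter_mem_B hP hQ))
  | empty : BRel (p R ∅ (empty_mem_B X)) 0
  | sts (a : 𝒜) : BRel (s R X a * t R X a * s R X a) (s R X a)
  | tst (a : 𝒜) : BRel (t R X a * s R X a * t R X a) (t R X a)
  | word (a : 𝒜) (α : List 𝒜) (b : 𝒜) (β : List 𝒜)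
      (hα : a :: α ∈ language X) (hβ : b :: β ∈ language X) :
      BRel (sWord R X b β * tWord R X a α * sWord R X a α * tWord R X b β)
        (p R (C X (a :: α) (b :: β)) (C_mem_B hα hβ (by simp)))
  | follower (a : 𝒜) (α : List 𝒜) (hα : a :: α ∈ language X) :
      BRel (tWord R X a α * sWord R X a α)
        (p R (C X (a :: α) []) (C_mem_B hα (nil_mem_language hα) (by simp)))
  | cylinder (b : 𝒜) (β : List 𝒜) (hβ : b :: β ∈ language X) :
      BRel (sWord R X b β * tWord R X b β)
        (p R (C X [] (b :: β)) (C_mem_B (nil_mem_language hβ) hβ (by simp)))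

/-- The subshift algebra `A_R(X)`: the universal, not necessarily unital, `R`-algebra with the
above generators and relations. -/
abbrev NonUnitalAlgebra : Type (max u v) := Presented (BRel R X)

/-- A not necessarily unital ring is unital if it has a two-sided identity element. -/
def IsUnital (A : Type w) [Mul A] : Prop := ∃ e : A, ∀ x : A, e * x = x ∧ x * e = x

end NonUnital

end SubshiftAlgebra

end

/-! The algebras 𝓑 and 𝓤 differ only by complements: every member of 𝓤 lies in 𝓑 or has its
complement in 𝓑 (`mem_B_or_compl_mem_B`). Sending generators to generators gives a homomorphism
`toUnital`, whose image generates the unital algebra together with 1, because p_P = 1 - p_{Pᶜ}.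
Hence the unitization of the subshift algebra always maps onto the unital one
(`lift_toUnital_surjective`).

In the other direction, a homomorphism j into a unital algebra extends along `toUnital` by p_P ↦ 1 -
j(p_{Pᶜ}) when Pᶜ ∈ 𝓑, provided that j(p_X) = 1 in case X ∈ 𝓑 (`exists_extension`). Everything then
depends on whether X ∈ 𝓑.

The projections p_P are local units (`exists_local_unit`), so X ∈ 𝓑 makes p_X an identity. Thus
without an identity X ∉ 𝓑, the proviso is vacuous, and extending the inclusion into the unitization
gives a left inverse of the surjection. Conversely, an identity equals some p_P by local units, and
a representation on functions, faithful enough to detect inclusions of sets when R ≠ 0, forces P = X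
(`univ_mem_B_of_isUnital`). Then p_X is the identity, and extending an isomorphism onto a unital
algebra shows that `toUnital` is injective; it is onto because it hits 1. The zero ring is trivial.
-/

noncomputable section

namespace SubshiftAlgebra

universe u v w

/-! ### Universal properties of the presented algebras -/

section Lift

variable {R : Type u} [CommRing R] {G : Type v} {E : Type w} [NonUnitalRing E] [Module R E]
  [IsScalarTower R E E] [SMulCommClass R E E]

/-- The homomorphism from the free non-unital algebra determined by the images of the
generators. -/
def NFree.lift (f : G → E) : NFree R G →ₙₐ[R] E :=
  MonoidAlgebra.liftMagma R (FreeSemigroup.lift f)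

@[simp]
theorem NFree.lift_ι (f : G → E) (g : G) : NFree.lift f (NFree.ι R g) = f g := by
  simp [NFree.lift, NFree.ι]

namespace Presented

variable {rel : NFree R G → NFree R G → Prop}

/-- A homomorphism from the free non-unital algebra respecting the relations descends to the
presented algebra. -/
def lift (f : NFree R G →ₙₐ[R] E) (hf : ∀ x y, rel x y → f x = f y) : Presented rel →ₙₐ[R] E where
  toFun := Quotient.lift (s := (presentedCon rel).toSetoid) f (by
    intro x y h
    change RingConGen.Rel _ x y at h
    induction h with
    | of x y h =>
      obtain ⟨r, a, b, hab, rfl, rfl⟩ := h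
      rw [map_smul, map_smul, hf a b hab]
    | refl => rfl
    | symm _ ih => exact ih.symm
    | trans _ _ ih₁ ih₂ => exact ih₁.trans ih₂
    | add _ _ ih₁ ih₂ => rw [map_add, map_add, ih₁, ih₂]
    | mul _ _ ih₁ ih₂ => rw [map_mul, map_mul, ih₁, ih₂])
  map_smul' r x := by
    obtain ⟨x, rfl⟩ := mk_surjective rel x
    exact map_smul f r x
  map_zero' := map_zero f
  map_add' x y := by
    obtain ⟨x, rfl⟩ := mk_surjective rel x
    obtain ⟨y, rfl⟩ := mk_surjective rel y
    exact map_add f x y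
  map_mul' x y := by
    obtain ⟨x, rfl⟩ := mk_surjective rel x
    obtain ⟨y, rfl⟩ := mk_surjective rel y
    exact map_mul f x y

omit [IsScalarTower R E E] [SMulCommClass R E E] in
@[simp]
theorem lift_mk (f : NFree R G →ₙₐ[R] E) (hf : ∀ x y, rel x y → f x = f y) (x : NFree R G) :
    lift f hf (mk rel x) = f x := rfl

variable (rel) in
/-- The quotient map as a homomorphism of algebras. -/
def mkHom : NFree R G →ₙₐ[R] Presented rel where
  toFun := mk rel
  map_smul' _ _ := rfl
  map_zero' := rfl
  map_add' _ _ := rfl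
  map_mul' _ _ := rfl

theorem mk_eq_of_rel {x y : NFree R G} (h : rel x y) : mk rel x = mk rel y :=
  Quotient.sound (s := (presentedCon rel).toSetoid)
    (RingConGen.Rel.of _ _ ⟨1, x, y, h, (one_smul _ _).symm, (one_smul _ _).symm⟩)

theorem induction {motive : Presented rel → Prop}
    (gen : ∀ g, motive (mk rel (NFree.ι R g))) (zero : motive 0)
    (smul : ∀ (r : R) x, motive x → motive (r • x))
    (add : ∀ x y, motive x → motive y → motive (x + y))
    (mul : ∀ x y, motive x → motive y → motive (x * y)) (x : Presented rel) : motive x := by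
  obtain ⟨x, rfl⟩ := mk_surjective rel x
  induction x using MonoidAlgebra.induction_linear with
  | zero => exact zero
  | add x y hx hy => exact add _ _ hx hy
  | single m r =>
    have h : MonoidAlgebra.single m r = r • (MonoidAlgebra.single m 1 : NFree R G) := by simp
    rw [h, ← smul_mk]
    refine smul _ _ ?_
    induction m using FreeSemigroup.recOnMul with
    | ih1 g => exact gen g
    | ih2 g m hg hm =>
      have h : (MonoidAlgebra.single (FreeSemigroup.of g * m) 1 : NFree R G) =
          MonoidAlgebra.single (FreeSemigroup.of g) 1 * MonoidAlgebra.single m 1 := by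
        simp [MonoidAlgebra.single_mul_single]
      rw [h, mk_mul]
      exact mul _ _ (hg (by simp)) (hm (by simp))

omit [IsScalarTower R E E] [SMulCommClass R E E] in
theorem hom_ext {f g : Presented rel →ₙₐ[R] E}
    (h : ∀ x, f (mk rel (NFree.ι R x)) = g (mk rel (NFree.ι R x))) : f = g := by
  ext x
  induction x using induction with
  | gen x => exact h x
  | zero => simp
  | smul r x hx => simp [hx]
  | add x y hx hy => simp [hx, hy]
  | mul x y hx hy => simp [hx, hy]

end Presented


variable (R E) in
/-- A ring with an identity element is isomorphic to a unital algebra. -/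
theorem IsUnital.exists_algebra (h : IsUnital E) :
    ∃ (E' : Type w) (_ : Ring E') (_ : Algebra R E') (i : E →ₙₐ[R] E'), Function.Bijective i := by
  obtain ⟨e, he⟩ := h
  -- Both structures extend those already on `E`, so the identity map serves as the isomorphism.
  let ring : Ring E :=
    { (inferInstance : NonUnitalRing E) with
      one := e
      one_mul := fun x => (he x).1
      mul_one := fun x => (he x).2 }
  let algebra : Algebra R E := Algebra.ofModule smul_mul_assoc mul_smul_comm
  exact ⟨E, ring, algebra, NonUnitalAlgHom.id R E, Function.bijective_id⟩

end Lift

/-! ### The two Boolean algebras -/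

section Sets

variable {𝒜 : Type v} {X : Set (Stream' 𝒜)}

theorem C_nil_nil (X : Set (Stream' 𝒜)) : C X [] [] = Set.univ :=
  Set.eq_univ_of_forall fun y => ⟨y, rfl, y.2⟩

theorem diff_mem_B {P Q : Set X} (hP : P ∈ B X) (hQ : Q ∈ B X) : P \ Q ∈ B X :=
  generateSetRing.diff _ _ hP hQ

theorem compl_mem_U {P : Set X} (hP : P ∈ U X) : Pᶜ ∈ U X :=
  MeasureTheory.isSetAlgebra_generateSetAlgebra.compl_mem hP

theorem B_subset_U (X : Set (Stream' 𝒜)) : B X ⊆ U X := by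
  intro P hP
  change generateSetRing _ P at hP
  induction hP with
  | base P hP =>
    obtain ⟨α, hα, β, hβ, -, rfl⟩ := hP
    exact C_mem_U hα hβ
  | empty => exact empty_mem_U X
  | union _ _ _ _ hP hQ => exact union_mem_U hP hQ
  | inter _ _ _ _ hP hQ => exact inter_mem_U hP hQ
  | diff _ _ _ _ hP hQ => exact MeasureTheory.isSetAlgebra_generateSetAlgebra.sdiff_mem hP hQ

/-- Every element of `𝓤` lies in `𝓑` or is the complement of an element of `𝓑`. -/
theorem mem_B_or_compl_mem_B {P : Set X} (hP : P ∈ U X) : P ∈ B X ∨ Pᶜ ∈ B X := by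
  change MeasureTheory.generateSetAlgebra _ P at hP
  induction hP with
  | base P hP =>
    obtain ⟨α, hα, β, hβ, rfl⟩ := hP
    by_cases h : α = [] ∧ β = []
    · rw [h.1, h.2, C_nil_nil, Set.compl_univ]
      exact Or.inr (empty_mem_B X)
    · exact Or.inl (C_mem_B hα hβ h)
  | empty => exact Or.inl (empty_mem_B X)
  | compl P _ ih => rwa [compl_compl, or_comm]
  | union P Q _ _ hP hQ =>
    rw [Set.compl_union]
    -- In the mixed cases the complement of the union is a difference of two members of 𝓑, such as
    -- Qᶜ \ P; relative complements suffice.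
    rcases hP with hP | hP <;> rcases hQ with hQ | hQ
    · exact Or.inl (union_mem_B hP hQ)
    · refine Or.inr ?_
      rw [Set.inter_comm, ← Set.sdiff_eq]
      exact diff_mem_B hQ hP
    · refine Or.inr ?_
      rw [← Set.sdiff_eq]
      exact diff_mem_B hP hQ
    · exact Or.inr (inter_mem_B hP hQ)

/-- The map on generators with values `P`, `S`, `T`. -/
def Gen.elim {S₀ : Type v} {𝒮 : Set (Set S₀)} {E : Type w} (P : 𝒮 → E) (S T : 𝒜 → E) :
    Gen 𝒜 𝒮 → E
  | .p A => P A
  | .s a => S a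
  | .t a => T a

end Sets

/-! ### Words and generators -/

section Words

variable {R : Type u} [CommRing R] {𝒜 : Type v} {X : Set (Stream' 𝒜)}
  {E : Type w} [Ring E] [Algebra R E]

/-- Inside a unital target, list products give a common form for the recursion over nonempty words
in `BFree` and the one over all words in `UFree`. -/
theorem BFree.map_sWord (f : BFree R X →ₙₐ[R] E) (a : 𝒜) (α : List 𝒜) :
    f (BFree.sWord R X a α) = ((a :: α).map fun c => f (BFree.s R X c)).prod := by
  induction α generalizing a with
  | nil => simp [BFree.sWord]
  | cons b α ih => rw [BFree.sWord, map_mul, ih, ← List.prod_cons, List.map_cons (a := a)]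

theorem BFree.map_tWord (f : BFree R X →ₙₐ[R] E) (a : 𝒜) (α : List 𝒜) :
    f (BFree.tWord R X a α) = ((a :: α).map fun c => f (BFree.t R X c)).reverse.prod := by
  induction α generalizing a with
  | nil => simp [BFree.tWord]
  | cons b α ih =>
    rw [BFree.tWord, map_mul, ih, List.map_cons (a := a), List.reverse_cons, List.prod_append,
      List.prod_singleton]

theorem UFree.map_sWord (f : UFree R X →ₐ[R] E) (α : List 𝒜) :
    f (UFree.sWord R X α) = (α.map fun c => f (UFree.s R X c)).prod := by
  induction α with
  | nil => simp [UFree.sWord]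
  | cons a α ih => rw [UFree.sWord, map_mul, ih, ← List.prod_cons, List.map_cons]

theorem UFree.map_tWord (f : UFree R X →ₐ[R] E) (α : List 𝒜) :
    f (UFree.tWord R X α) = (α.map fun c => f (UFree.t R X c)).reverse.prod := by
  induction α with
  | nil => simp [UFree.tWord]
  | cons a α ih =>
    rw [UFree.tWord, map_mul, ih, List.map_cons, List.reverse_cons, List.prod_append,
      List.prod_singleton]

end Words

/-! ### The canonical homomorphism -/

section Canonical

variable (R : Type u) [CommRing R] {𝒜 : Type v} (X : Set (Stream' 𝒜))

/-- The quotient map onto the unital subshift algebra. -/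
def UnitalAlgebra.mk : UFree R X →ₐ[R] UnitalAlgebra R X :=
  RingQuot.mkAlgHom R (URel R X)

variable {R X}

theorem UnitalAlgebra.mk_eq_of_rel {x y : UFree R X} (h : URel R X x y) : mk R X x = mk R X y :=
  RingQuot.mkAlgHom_rel R h

/-- The universal property of the unital subshift algebra. -/
def UnitalAlgebra.lift {E : Type w} [Ring E] [Algebra R E] (f : UFree R X →ₐ[R] E)
    (hf : ∀ ⦃x y⦄, URel R X x y → f x = f y) : UnitalAlgebra R X →ₐ[R] E :=
  RingQuot.liftAlgHom R ⟨f, hf⟩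

@[simp]
theorem UnitalAlgebra.lift_mk {E : Type w} [Ring E] [Algebra R E] (f : UFree R X →ₐ[R] E)
    (hf : ∀ ⦃x y⦄, URel R X x y → f x = f y) (x : UFree R X) : lift f hf (mk R X x) = f x :=
  RingQuot.liftAlgHom_mkAlgHom_apply R f hf x

theorem UnitalAlgebra.mk_surjective : Function.Surjective (mk R X) :=
  RingQuot.mkAlgHom_surjective R _

variable (R X)

/-- The generators of the subshift algebra, mapped to the unital subshift algebra. -/
def genToUnital : Gen 𝒜 (B X) → UnitalAlgebra R X :=
  Gen.elim (fun A => UnitalAlgebra.mk R X (UFree.p R A.1 (B_subset_U X A.2)))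
    (fun a => UnitalAlgebra.mk R X (UFree.s R X a)) fun a => UnitalAlgebra.mk R X (UFree.t R X a)

theorem lift_genToUnital_p (A : Set X) (hA : A ∈ B X) :
    NFree.lift (genToUnital R X) (BFree.p R A hA) =
      UnitalAlgebra.mk R X (UFree.p R A (B_subset_U X hA)) :=
  NFree.lift_ι _ _

theorem lift_genToUnital_s (a : 𝒜) :
    NFree.lift (genToUnital R X) (BFree.s R X a) = UnitalAlgebra.mk R X (UFree.s R X a) :=
  NFree.lift_ι _ _

theorem lift_genToUnital_t (a : 𝒜) :
    NFree.lift (genToUnital R X) (BFree.t R X a) = UnitalAlgebra.mk R X (UFree.t R X a) :=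
  NFree.lift_ι _ _

theorem lift_genToUnital_sWord (a : 𝒜) (α : List 𝒜) :
    NFree.lift (genToUnital R X) (BFree.sWord R X a α) =
      UnitalAlgebra.mk R X (UFree.sWord R X (a :: α)) := by
  simp only [BFree.map_sWord, UFree.map_sWord, lift_genToUnital_s]

theorem lift_genToUnital_tWord (a : 𝒜) (α : List 𝒜) :
    NFree.lift (genToUnital R X) (BFree.tWord R X a α) =
      UnitalAlgebra.mk R X (UFree.tWord R X (a :: α)) := by
  simp only [BFree.map_tWord, UFree.map_tWord, lift_genToUnital_t]

/-- The canonical homomorphism from the subshift algebra to the unital subshift algebra. -/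
def toUnital : NonUnitalAlgebra R X →ₙₐ[R] UnitalAlgebra R X :=
  Presented.lift (NFree.lift (genToUnital R X)) (by
    intro x y h
    induction h with
    | inter P Q hP hQ =>
      simpa only [lift_genToUnital_p, map_mul] using UnitalAlgebra.mk_eq_of_rel
        (URel.inter P Q (B_subset_U X hP) (B_subset_U X hQ))
    | union P Q hP hQ =>
      simpa only [lift_genToUnital_p, map_sub, map_add] using UnitalAlgebra.mk_eq_of_rel
        (URel.union P Q (B_subset_U X hP) (B_subset_U X hQ))
    | empty =>
      simpa only [lift_genToUnital_p, map_zero] using UnitalAlgebra.mk_eq_of_rel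
        (URel.empty (R := R) (X := X))
    | sts a =>
      simpa only [lift_genToUnital_s, lift_genToUnital_t, map_mul] using
        UnitalAlgebra.mk_eq_of_rel (URel.sts (R := R) (X := X) a)
    | tst a =>
      simpa only [lift_genToUnital_s, lift_genToUnital_t, map_mul] using
        UnitalAlgebra.mk_eq_of_rel (URel.tst (R := R) (X := X) a)
    | word a α b β hα hβ =>
      simpa only [lift_genToUnital_sWord, lift_genToUnital_tWord, lift_genToUnital_p, map_mul] using
        UnitalAlgebra.mk_eq_of_rel (URel.word (R := R) _ _ hα hβ)
    | follower a α hα =>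
      simpa only [lift_genToUnital_sWord, lift_genToUnital_tWord, lift_genToUnital_p, map_mul,
        UFree.sWord, UFree.tWord, one_mul, mul_one] using
        UnitalAlgebra.mk_eq_of_rel (URel.word (R := R) _ _ hα (nil_mem_language hα))
    | cylinder b β hβ =>
      simpa only [lift_genToUnital_sWord, lift_genToUnital_tWord, lift_genToUnital_p, map_mul,
        UFree.sWord, UFree.tWord, one_mul, mul_one] using
        UnitalAlgebra.mk_eq_of_rel (URel.word (R := R) _ _ (nil_mem_language hβ) hβ))

/-- The projection `p_A` of the subshift algebra. -/
def proj {X : Set (Stream' 𝒜)} (A : Set X) (hA : A ∈ B X) : NonUnitalAlgebra R X :=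
  Presented.mk _ (BFree.p R A hA)

theorem toUnital_p (A : Set X) (hA : A ∈ B X) :
    toUnital R X (proj R A hA) = UnitalAlgebra.mk R X (UFree.p R A (B_subset_U X hA)) :=
  lift_genToUnital_p R X A hA

theorem toUnital_s (a : 𝒜) :
    toUnital R X (Presented.mk _ (BFree.s R X a)) = UnitalAlgebra.mk R X (UFree.s R X a) :=
  lift_genToUnital_s R X a

theorem toUnital_t (a : 𝒜) :
    toUnital R X (Presented.mk _ (BFree.t R X a)) = UnitalAlgebra.mk R X (UFree.t R X a) :=
  lift_genToUnital_t R X a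

/-- P and Pᶜ are disjoint with union X, and p_X = 1. This recovers the generators p_P with P outside
𝓑. -/
theorem mk_p_eq_one_sub {P : Set X} (hP : P ∈ U X) :
    UnitalAlgebra.mk R X (UFree.p R P hP) =
      1 - UnitalAlgebra.mk R X (UFree.p R Pᶜ (compl_mem_U hP)) := by
  have h := UnitalAlgebra.mk_eq_of_rel (URel.union (R := R) P Pᶜ hP (compl_mem_U hP))
  have h₁ := UnitalAlgebra.mk_eq_of_rel (URel.univ (R := R) (X := X))
  have h₀ := UnitalAlgebra.mk_eq_of_rel (URel.empty (R := R) (X := X))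
  simp only [Set.union_compl_self, Set.inter_compl_self, map_sub, map_add, h₀, h₁, map_zero,
    map_one, sub_zero] at h
  exact eq_sub_of_add_eq h.symm

/-- The unital subshift algebra is generated by the image of the subshift algebra and `1`. -/
theorem lift_toUnital_surjective :
    Function.Surjective (Unitization.lift (toUnital R X)) := by
  have hA : ∀ x, toUnital R X x ∈ (Unitization.lift (toUnital R X)).range := fun x =>
    ⟨(x : Unitization R (NonUnitalAlgebra R X)), by simp⟩
  have key : ∀ x : UFree R X,
      UnitalAlgebra.mk R X x ∈ (Unitization.lift (toUnital R X)).range := by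
    intro x
    induction x using FreeAlgebra.induction with
    | grade0 r => rw [AlgHom.commutes]; exact Subalgebra.algebraMap_mem _ r
    | mul x y hx hy => rw [map_mul]; exact Subalgebra.mul_mem _ hx hy
    | add x y hx hy => rw [map_add]; exact Subalgebra.add_mem _ hx hy
    | grade1 g =>
      cases g with
      | p A =>
        change UnitalAlgebra.mk R X (UFree.p R A.1 A.2) ∈ _
        rcases mem_B_or_compl_mem_B A.2 with h | h
        · rw [← toUnital_p R X A.1 h]
          exact hA _
        · rw [mk_p_eq_one_sub, ← toUnital_p R X _ h]
          exact Subalgebra.sub_mem _ (Subalgebra.one_mem _) (hA _)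
      | s a =>
        change UnitalAlgebra.mk R X (UFree.s R X a) ∈ _
        rw [← toUnital_s]
        exact hA _
      | t a =>
        change UnitalAlgebra.mk R X (UFree.t R X a) ∈ _
        rw [← toUnital_t]
        exact hA _
  intro y
  obtain ⟨x, rfl⟩ := UnitalAlgebra.mk_surjective y
  exact key x

end Canonical

/-! ### Extending homomorphisms to the unital subshift algebra -/

section Extend

variable {R : Type u} [CommRing R] {𝒜 : Type v} {X : Set (Stream' 𝒜)}

theorem proj_inter {P Q : Set X} (hP : P ∈ B X) (hQ : Q ∈ B X) :
    proj R (P ∩ Q) (inter_mem_B hP hQ) = proj R P hP * proj R Q hQ :=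
  Presented.mk_eq_of_rel (BRel.inter P Q hP hQ)

theorem proj_union {P Q : Set X} (hP : P ∈ B X) (hQ : Q ∈ B X) :
    proj R (P ∪ Q) (union_mem_B hP hQ) =
      proj R P hP + proj R Q hQ - proj R (P ∩ Q) (inter_mem_B hP hQ) :=
  (Presented.mk_eq_of_rel (BRel.union P Q hP hQ)).trans
    ((map_sub (Presented.mkHom (BRel R X)) _ _).trans
      (congrArg (· - _) (map_add (Presented.mkHom (BRel R X)) _ _)))

theorem proj_empty : proj R ∅ (empty_mem_B X) = 0 :=
  Presented.mk_eq_of_rel BRel.empty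

variable {E : Type w} [Ring E] [Algebra R E] (j : NonUnitalAlgebra R X →ₙₐ[R] E)

open Classical in
/-- The images of the projections `p_A`, `A ∈ 𝓑`, extended by `0` to all sets. -/
def imageProj (P : Set X) : E :=
  if hP : P ∈ B X then j (proj R P hP) else 0

theorem imageProj_of_mem {P : Set X} (hP : P ∈ B X) : imageProj j P = j (proj R P hP) :=
  dif_pos hP

theorem imageProj_inter {P Q : Set X} (hP : P ∈ B X) (hQ : Q ∈ B X) :
    imageProj j (P ∩ Q) = imageProj j P * imageProj j Q := by
  rw [imageProj_of_mem j hP, imageProj_of_mem j hQ, imageProj_of_mem j (inter_mem_B hP hQ),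
    proj_inter, map_mul]

theorem imageProj_union {P Q : Set X} (hP : P ∈ B X) (hQ : Q ∈ B X) :
    imageProj j (P ∪ Q) = imageProj j P + imageProj j Q - imageProj j (P ∩ Q) := by
  rw [imageProj_of_mem j hP, imageProj_of_mem j hQ, imageProj_of_mem j (inter_mem_B hP hQ),
    imageProj_of_mem j (union_mem_B hP hQ), proj_union, map_sub, map_add]

theorem imageProj_empty : imageProj j (∅ : Set X) = 0 := by
  rw [imageProj_of_mem j (empty_mem_B X), proj_empty, map_zero]

/-- P is the disjoint union of P \ Q and P ∩ Q. -/
theorem imageProj_diff {P Q : Set X} (hP : P ∈ B X) (hQ : Q ∈ B X) :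
    imageProj j (P \ Q) = imageProj j P - imageProj j P * imageProj j Q := by
  have h := imageProj_union j (diff_mem_B hP hQ) (inter_mem_B hP hQ)
  have h₀ : P \ Q ∩ (P ∩ Q) = ∅ := by
    ext x
    simp only [Set.mem_inter_iff, Set.mem_sdiff, Set.mem_empty_iff_false]
    tauto
  rw [Set.sdiff_union_inter, h₀, imageProj_empty, sub_zero, imageProj_inter j hP hQ] at h
  exact eq_sub_of_add_eq h.symm

open Classical in
/-- The images of the projections `p_A`, `A ∈ 𝓑`, extended to complements of elements of `𝓑`. -/
def extendProj (P : Set X) : E :=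
  if P ∈ B X then imageProj j P else 1 - imageProj j Pᶜ

theorem extendProj_of_mem {P : Set X} (hP : P ∈ B X) : extendProj j P = imageProj j P :=
  if_pos hP

variable (hj : ∀ h : Set.univ ∈ B X, j (proj R Set.univ h) = 1)

include hj

/-- This is the consistency of the two branches of `extendProj`: if P and Pᶜ both lie in 𝓑, so does
their union X, and `hj` gives p_P + p_{Pᶜ} ↦ 1. When X ∉ 𝓑 there is no overlap and `hj` is vacuous.
-/
theorem extendProj_of_compl_mem {P : Set X} (hP : Pᶜ ∈ B X) :
    extendProj j P = 1 - imageProj j Pᶜ := by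
  by_cases h : P ∈ B X
  · have h₁ := imageProj_union j h hP
    have hu : Set.univ ∈ B X := Set.union_compl_self P ▸ union_mem_B h hP
    rw [Set.union_compl_self, Set.inter_compl_self, imageProj_empty, sub_zero,
      imageProj_of_mem j hu, hj] at h₁
    rw [extendProj_of_mem j h]
    exact eq_sub_of_add_eq h₁.symm
  · exact if_neg h

theorem extendProj_compl {P : Set X} (hP : P ∈ U X) : extendProj j Pᶜ = 1 - extendProj j P := by
  rcases mem_B_or_compl_mem_B hP with h | h
  · rw [extendProj_of_mem j h, extendProj_of_compl_mem j hj (by rwa [compl_compl]), compl_compl]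
  · rw [extendProj_of_mem j h, extendProj_of_compl_mem j hj h, sub_sub_cancel]

/-- A mixed intersection is a difference P \ Qᶜ inside 𝓑; for two complements the identity is (1 -
p)(1 - q) = 1 - (p + q - pq). -/
theorem extendProj_inter {P Q : Set X} (hP : P ∈ U X) (hQ : Q ∈ U X) :
    extendProj j (P ∩ Q) = extendProj j P * extendProj j Q := by
  have aux : ∀ {P Q : Set X}, P ∈ B X → Qᶜ ∈ B X →
      extendProj j (P ∩ Q) = imageProj j P - imageProj j P * imageProj j Qᶜ := by
    intro P Q hP hQ
    have h : P ∩ Q = P \ Qᶜ := by rw [Set.sdiff_eq, compl_compl]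
    rw [h, extendProj_of_mem j (diff_mem_B hP hQ), imageProj_diff j hP hQ]
  rcases mem_B_or_compl_mem_B hP with h | h <;> rcases mem_B_or_compl_mem_B hQ with h' | h'
  · rw [extendProj_of_mem j h, extendProj_of_mem j h', extendProj_of_mem j (inter_mem_B h h'),
      imageProj_inter j h h']
  · rw [aux h h', extendProj_of_mem j h, extendProj_of_compl_mem j hj h', mul_sub, mul_one]
  -- `aux` produces the product in the opposite order; the factors commute because both products
  -- come from the same intersection.
  · rw [Set.inter_comm, aux h' h, extendProj_of_mem j h', extendProj_of_compl_mem j hj h, sub_mul,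
      one_mul, ← imageProj_inter j h' h, ← imageProj_inter j h h', Set.inter_comm]
  · rw [extendProj_of_compl_mem j hj h, extendProj_of_compl_mem j hj h',
      extendProj_of_compl_mem j hj (by rw [Set.compl_inter]; exact union_mem_B h h'),
      Set.compl_inter, imageProj_union j h h', imageProj_inter j h h']
    noncomm_ring

theorem extendProj_union {P Q : Set X} (hP : P ∈ U X) (hQ : Q ∈ U X) :
    extendProj j (P ∪ Q) = extendProj j P + extendProj j Q - extendProj j (P ∩ Q) := by
  have h : P ∪ Q = (Pᶜ ∩ Qᶜ)ᶜ := by rw [Set.compl_inter, compl_compl, compl_compl]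
  rw [h, extendProj_compl j hj (inter_mem_U (compl_mem_U hP) (compl_mem_U hQ)),
    extendProj_inter j hj (compl_mem_U hP) (compl_mem_U hQ), extendProj_compl j hj hP,
    extendProj_compl j hj hQ, extendProj_inter j hj hP hQ]
  noncomm_ring

/-- A homomorphism from the subshift algebra to a unital algebra that maps `p_X` to `1` if
`X ∈ 𝓑` extends along the canonical homomorphism to the unital subshift algebra. -/
theorem exists_extension :
    ∃ ψ : UnitalAlgebra R X →ₐ[R] E, ∀ x, ψ (toUnital R X x) = j x := by
  let f : UFree R X →ₐ[R] E := FreeAlgebra.lift R (Gen.elim (fun A => extendProj j A.1)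
    (fun a => j (Presented.mk _ (BFree.s R X a))) fun a => j (Presented.mk _ (BFree.t R X a)))
  -- Since `k` factors through the subshift algebra, it respects `BRel`; matching `f` with `k` on
  -- generators and words transfers those relations to `f`.
  let k : BFree R X →ₙₐ[R] E := j.comp (Presented.mkHom (BRel R X))
  have hk : ∀ {x y}, BRel R X x y → k x = k y := fun h =>
    congrArg j (Presented.mk_eq_of_rel h)
  have hp : ∀ (A : Set X) (hA : A ∈ U X), f (UFree.p R A hA) = extendProj j A := fun A hA =>
    FreeAlgebra.lift_ι_apply _ _
  have hpk : ∀ (A : Set X) (hA : A ∈ B X), extendProj j A = k (BFree.p R A hA) := fun A hA => by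
    rw [extendProj_of_mem j hA, imageProj_of_mem j hA]; rfl
  have hs : ∀ a : 𝒜, f (UFree.s R X a) = k (BFree.s R X a) := fun a =>
    FreeAlgebra.lift_ι_apply _ _
  have ht : ∀ a : 𝒜, f (UFree.t R X a) = k (BFree.t R X a) := fun a =>
    FreeAlgebra.lift_ι_apply _ _
  have hsw : ∀ (a : 𝒜) (α : List 𝒜), f (UFree.sWord R X (a :: α)) = k (BFree.sWord R X a α) := by
    intro a α
    simp only [BFree.map_sWord, UFree.map_sWord, hs]
  have htw : ∀ (a : 𝒜) (α : List 𝒜), f (UFree.tWord R X (a :: α)) = k (BFree.tWord R X a α) := by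
    intro a α
    simp only [BFree.map_tWord, UFree.map_tWord, ht]
  have hnil : f (UFree.sWord R X []) = 1 ∧ f (UFree.tWord R X []) = 1 := ⟨map_one f, map_one f⟩
  have huniv : extendProj j (Set.univ : Set X) = 1 := by
    rw [← Set.compl_empty, extendProj_compl j hj (empty_mem_U X),
      extendProj_of_mem j (empty_mem_B X), imageProj_empty, sub_zero]
  have hf : ∀ ⦃x y⦄, URel R X x y → f x = f y := by
    intro x y h
    induction h with
    | univ => rw [hp, map_one, huniv]
    | inter P Q hP hQ => rw [map_mul, hp, hp, hp, extendProj_inter j hj hP hQ]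
    | union P Q hP hQ => rw [map_sub, map_add, hp, hp, hp, hp, extendProj_union j hj hP hQ]
    | empty => rw [hp, map_zero, extendProj_of_mem j (empty_mem_B X), imageProj_empty]
    | sts a => simpa only [map_mul, hs, ht] using hk (BRel.sts a)
    | tst a => simpa only [map_mul, hs, ht] using hk (BRel.tst a)
    | word α β hα hβ =>
      rw [map_mul, map_mul, map_mul, hp]
      -- The unital word relation splits by emptiness of the words into p_X = 1 and the three word
      -- relations of the subshift algebra.
      rcases α with _ | ⟨a, α⟩ <;> rcases β with _ | ⟨b, β⟩
      · simp only [hnil, mul_one, C_nil_nil, huniv]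
      · rw [hnil.1, hnil.2, mul_one, mul_one, hsw, htw, hpk _ (C_mem_B hα hβ (by simp)), ← map_mul]
        exact hk (BRel.cylinder b β hβ)
      · rw [hnil.1, hnil.2, mul_one, one_mul, hsw, htw, hpk _ (C_mem_B hα hβ (by simp)), ← map_mul]
        exact hk (BRel.follower a α hα)
      · rw [hsw, htw, hsw, htw, hpk _ (C_mem_B hα hβ (by simp)), ← map_mul, ← map_mul, ← map_mul]
        exact hk (BRel.word a α b β hα hβ)
  let ψ := UnitalAlgebra.lift f hf
  refine ⟨ψ, fun x => ?_⟩
  have h : ((ψ : UnitalAlgebra R X →ₙₐ[R] E).comp (toUnital R X)) = j := by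
    refine Presented.hom_ext fun g => ?_
    cases g with
    | p A =>
      exact (congrArg ψ (toUnital_p R X A.1 A.2)).trans
        ((UnitalAlgebra.lift_mk f hf _).trans ((hp _ _).trans (hpk _ A.2)))
    | s a =>
      exact (congrArg ψ (toUnital_s R X a)).trans ((UnitalAlgebra.lift_mk f hf _).trans (hs a))
    | t a =>
      exact (congrArg ψ (toUnital_t R X a)).trans ((UnitalAlgebra.lift_mk f hf _).trans (ht a))
  exact DFunLike.congr_fun h x

end Extend

/-! ### Local units -/

section LocalUnits

variable (R : Type u) [CommRing R] {𝒜 : Type v} {X : Set (Stream' 𝒜)}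

theorem proj_mul_of_subset {P Q : Set X} (hP : P ∈ B X) (hQ : Q ∈ B X) (h : P ⊆ Q) :
    proj R P hP * proj R Q hQ = proj R P hP ∧ proj R Q hQ * proj R P hP = proj R P hP := by
  rw [← proj_inter, ← proj_inter]
  simp only [Set.inter_eq_left.2 h, Set.inter_eq_right.2 h, and_self]

variable {R}

/-- Projections onto larger sets are local units as well. -/
theorem local_unit_mono {P Q : Set X} (hP : P ∈ B X) (hQ : Q ∈ B X) (h : P ⊆ Q)
    (x : NonUnitalAlgebra R X) :
    (proj R P hP * x = x → proj R Q hQ * x = x) ∧ (x * proj R P hP = x → x * proj R Q hQ = x) := by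
  obtain ⟨h₁, h₂⟩ := proj_mul_of_subset R hP hQ h
  constructor <;> intro hx
  · rw [← hx, ← mul_assoc, h₂]
  · rw [← hx, mul_assoc, h₁]

/-- From s_a = s_a s_a^* s_a, the projection onto C(ω, a) fixes s_a on the left and that onto C(a,
ω) fixes it on the right; for s_a^* the roles swap. Passing to unions merges local units, since a
larger set still works. The relations invoked require each letter to be in the language. -/
theorem exists_local_unit (hletters : ∀ a : 𝒜, [a] ∈ language X) (x : NonUnitalAlgebra R X) :
    ∃ (P : Set X) (hP : P ∈ B X), proj R P hP * x = x ∧ x * proj R P hP = x := by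
  have cyl : ∀ a : 𝒜, C X [] [a] ∈ B X := fun a =>
    C_mem_B (nil_mem_language (hletters a)) (hletters a) (by simp)
  have fol : ∀ a : 𝒜, C X [a] [] ∈ B X := fun a =>
    C_mem_B (hletters a) (nil_mem_language (hletters a)) (by simp)
  have hcyl : ∀ a : 𝒜, (Presented.mk (BRel R X) (BFree.s R X a)) * Presented.mk _ (BFree.t R X a) =
      proj R _ (cyl a) := fun a => Presented.mk_eq_of_rel (BRel.cylinder a [] (hletters a))
  have hfol : ∀ a : 𝒜, (Presented.mk (BRel R X) (BFree.t R X a)) * Presented.mk _ (BFree.s R X a) =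
      proj R _ (fol a) := fun a => Presented.mk_eq_of_rel (BRel.follower a [] (hletters a))
  have hsts : ∀ a : 𝒜, (Presented.mk (BRel R X) (BFree.s R X a)) * Presented.mk _ (BFree.t R X a) *
      Presented.mk _ (BFree.s R X a) = Presented.mk _ (BFree.s R X a) := fun a =>
    Presented.mk_eq_of_rel (BRel.sts a)
  have htst : ∀ a : 𝒜, (Presented.mk (BRel R X) (BFree.t R X a)) * Presented.mk _ (BFree.s R X a) *
      Presented.mk _ (BFree.t R X a) = Presented.mk _ (BFree.t R X a) := fun a =>
    Presented.mk_eq_of_rel (BRel.tst a)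
  have join : ∀ {x y : NonUnitalAlgebra R X} {P Q : Set X} (hP : P ∈ B X) (hQ : Q ∈ B X),
      proj R P hP * x = x → y * proj R Q hQ = y →
      proj R _ (union_mem_B hP hQ) * x = x ∧ y * proj R _ (union_mem_B hP hQ) = y :=
    fun hP hQ hx hy => ⟨(local_unit_mono hP _ Set.subset_union_left _).1 hx,
      (local_unit_mono hQ _ Set.subset_union_right _).2 hy⟩
  induction x using Presented.induction with
  | gen g =>
    cases g with
    | p A => exact ⟨A.1, A.2, proj_mul_of_subset R A.2 A.2 subset_rfl⟩
    | s a =>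
      refine ⟨_, _, join (cyl a) (fol a) ?_ ?_⟩
      · rw [← hcyl]
        exact hsts a
      · rw [← hfol]
        exact (mul_assoc _ _ _).symm.trans (hsts a)
    | t a =>
      refine ⟨_, _, join (fol a) (cyl a) ?_ ?_⟩
      · rw [← hfol]
        exact htst a
      · rw [← hcyl]
        exact (mul_assoc _ _ _).symm.trans (htst a)
  | zero => exact ⟨∅, empty_mem_B X, mul_zero _, zero_mul _⟩
  | smul r x hx =>
    obtain ⟨P, hP, h₁, h₂⟩ := hx
    exact ⟨P, hP, by rw [mul_smul_comm, h₁], by rw [smul_mul_assoc, h₂]⟩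
  | add x y hx hy =>
    obtain ⟨P, hP, h₁, h₂⟩ := hx
    obtain ⟨Q, hQ, h₃, h₄⟩ := hy
    have hx := local_unit_mono hP (union_mem_B hP hQ) Set.subset_union_left x
    have hy := local_unit_mono hQ (union_mem_B hP hQ) Set.subset_union_right y
    exact ⟨P ∪ Q, union_mem_B hP hQ, by rw [mul_add, hx.1 h₁, hy.1 h₃],
      by rw [add_mul, hx.2 h₂, hy.2 h₄]⟩
  -- Only the left unit of `x` and the right unit of `y` matter for the product.
  | mul x y hx hy =>
    obtain ⟨P, hP, h₁, -⟩ := hx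
    obtain ⟨Q, hQ, -, h₄⟩ := hy
    obtain ⟨h, h'⟩ := join hP hQ h₁ h₄
    exact ⟨_, _, by rw [← mul_assoc, h], by rw [mul_assoc, h']⟩

/-- If `X ∈ 𝓑`, then `p_X` is an identity element of the subshift algebra. -/
theorem proj_univ_mul (hletters : ∀ a : 𝒜, [a] ∈ language X) (h : Set.univ ∈ B X)
    (x : NonUnitalAlgebra R X) :
    proj R Set.univ h * x = x ∧ x * proj R Set.univ h = x := by
  obtain ⟨P, hP, h₁, h₂⟩ := exists_local_unit hletters x
  have hm := local_unit_mono hP h (Set.subset_univ P) x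
  exact ⟨hm.1 h₁, hm.2 h₂⟩

end LocalUnits

/-! ### Shift invariance -/

section Shift

variable {𝒜 : Type v} {X : Set (Stream' 𝒜)}

theorem IsSubshift.of_cons_mem (hX : IsSubshift X) {a : 𝒜} {x : Stream' 𝒜}
    (h : Stream'.cons a x ∈ X) : x ∈ X := by
  obtain ⟨F, rfl⟩ := hX
  rintro w hw ⟨i, hi⟩
  -- A block of x at position i is a block of ax at position i + 1.
  exact h w hw ⟨i + 1, hi⟩

theorem IsSubshift.of_append_mem (hX : IsSubshift X) {α : List 𝒜} {x : Stream' 𝒜}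
    (h : Stream'.appendStream' α x ∈ X) : x ∈ X := by
  induction α with
  | nil => exact h
  | cons a α ih => exact ih (hX.of_cons_mem h)

end Shift

/-! ### The representation on functions on sequences -/

section Representation

variable (R : Type u) [CommRing R] {𝒜 : Type v}

open Classical in
/-- The operator that composes a function with the partial map `θ` with domain `D`, and extends
the result by zero. -/
def partialComp (D : Set (Stream' 𝒜)) (θ : Stream' 𝒜 → Stream' 𝒜) :
    Module.End R (Stream' 𝒜 → R) where
  toFun f x := if x ∈ D then f (θ x) else 0
  map_add' f g := by
    ext x
    by_cases h : x ∈ D <;> simp [h]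
  map_smul' r f := by
    ext x
    by_cases h : x ∈ D <;> simp [h]

variable {R}

theorem partialComp_apply_of_mem {D : Set (Stream' 𝒜)} {θ : Stream' 𝒜 → Stream' 𝒜}
    (f : Stream' 𝒜 → R) {x : Stream' 𝒜} (hx : x ∈ D) : partialComp R D θ f x = f (θ x) :=
  if_pos hx

theorem partialComp_apply_of_notMem {D : Set (Stream' 𝒜)} {θ : Stream' 𝒜 → Stream' 𝒜}
    (f : Stream' 𝒜 → R) {x : Stream' 𝒜} (hx : x ∉ D) : partialComp R D θ f x = 0 :=
  if_neg hx

/-- Precomposition is contravariant, so the maps appear in reverse order. With `partialComp_congr`,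
checking the multiplicative relations reduces to comparing domains and maps. -/
theorem partialComp_mul (D D' : Set (Stream' 𝒜)) (θ θ' : Stream' 𝒜 → Stream' 𝒜) :
    partialComp R D θ * partialComp R D' θ' = partialComp R (D ∩ θ ⁻¹' D') (θ' ∘ θ) := by
  ext f x
  rw [Module.End.mul_apply]
  by_cases h : x ∈ D
  · by_cases h' : θ x ∈ D'
    · rw [partialComp_apply_of_mem _ h, partialComp_apply_of_mem _ h',
        partialComp_apply_of_mem (D := D ∩ θ ⁻¹' D') _ ⟨h, h'⟩, Function.comp_apply]
    · rw [partialComp_apply_of_mem _ h, partialComp_apply_of_notMem _ h',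
        partialComp_apply_of_notMem (D := D ∩ θ ⁻¹' D') _ fun hx => h' hx.2]
  · rw [partialComp_apply_of_notMem _ h, partialComp_apply_of_notMem (D := D ∩ θ ⁻¹' D') _ fun hx => h hx.1]

theorem partialComp_congr {D D' : Set (Stream' 𝒜)} {θ θ' : Stream' 𝒜 → Stream' 𝒜}
    (h : ∀ x, x ∈ D ↔ x ∈ D') (hθ : ∀ x ∈ D, θ x = θ' x) :
    partialComp R D θ = partialComp R D' θ' := by
  obtain rfl : D = D' := Set.ext h
  ext f x
  by_cases hx : x ∈ D
  · rw [partialComp_apply_of_mem _ hx, partialComp_apply_of_mem _ hx, hθ x hx]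
  · rw [partialComp_apply_of_notMem _ hx, partialComp_apply_of_notMem _ hx]

/-- The sequences of `X` that start with the word `α`. -/
def cylinder (X : Set (Stream' 𝒜)) (α : List 𝒜) : Set (Stream' 𝒜) :=
  {x ∈ X | ∃ y, x = Stream'.appendStream' α y}

variable (R) (X : Set (Stream' 𝒜))

/-- The image of `p_A`: multiplication with an indicator function. -/
def projOp (A : Set X) : Module.End R (Stream' 𝒜 → R) :=
  partialComp R (Subtype.val '' A) id

/-- The image of `s_α`. -/
def shiftOp (α : List 𝒜) : Module.End R (Stream' 𝒜 → R) :=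
  partialComp R (cylinder X α) (Stream'.drop α.length)

/-- The image of `s_α^*`. -/
def unshiftOp (α : List 𝒜) : Module.End R (Stream' 𝒜 → R) :=
  partialComp R {x | Stream'.appendStream' α x ∈ X} (Stream'.appendStream' α)

variable {X}

/-- The domains agree by shift invariance: αβz ∈ X forces βz ∈ X. -/
theorem shiftOp_append (hX : IsSubshift X) (α β : List 𝒜) :
    shiftOp R X α * shiftOp R X β = shiftOp R X (α ++ β) := by
  rw [shiftOp, shiftOp, shiftOp, partialComp_mul]
  refine partialComp_congr (fun x => ⟨?_, ?_⟩) ?_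
  · rintro ⟨⟨hx, y, rfl⟩, -, z, hz⟩
    rw [Stream'.drop_append_stream] at hz
    exact ⟨hx, z, by rw [hz, Stream'.append_append_stream]⟩
  · rintro ⟨hx, z, rfl⟩
    rw [Stream'.append_append_stream] at hx ⊢
    refine ⟨⟨hx, _, rfl⟩, ?_⟩
    rw [Set.mem_preimage, Stream'.drop_append_stream]
    exact ⟨hX.of_append_mem hx, z, rfl⟩
  · intro x _
    rw [Function.comp_apply, Stream'.drop_drop, List.length_append]

theorem unshiftOp_append (hX : IsSubshift X) (α β : List 𝒜) :
    unshiftOp R X β * unshiftOp R X α = unshiftOp R X (α ++ β) := by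
  rw [unshiftOp, unshiftOp, unshiftOp, partialComp_mul]
  refine partialComp_congr (fun x => ⟨?_, ?_⟩) ?_
  · rintro ⟨-, hx⟩
    rwa [Set.mem_ofPred_eq, Stream'.append_append_stream]
  · intro hx
    rw [Set.mem_ofPred_eq, Stream'.append_append_stream] at hx
    exact ⟨hX.of_append_mem hx, hx⟩
  · intro x _
    rw [Function.comp_apply, Stream'.append_append_stream]

theorem projOp_inter (P Q : Set X) : projOp R X (P ∩ Q) = projOp R X P * projOp R X Q := by
  rw [projOp, projOp, projOp, partialComp_mul, Set.image_inter Subtype.val_injective]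
  rfl

theorem projOp_union (P Q : Set X) :
    projOp R X (P ∪ Q) = projOp R X P + projOp R X Q - projOp R X (P ∩ Q) := by
  ext f x
  rw [projOp, projOp, projOp, projOp, Set.image_union, Set.image_inter Subtype.val_injective]
  by_cases hP : x ∈ Subtype.val '' P <;> by_cases hQ : x ∈ Subtype.val '' Q <;>
    simp only [partialComp, Set.mem_union, Set.mem_inter_iff, hP, hQ, LinearMap.sub_apply,
      LinearMap.add_apply, LinearMap.coe_mk, AddHom.coe_mk, Pi.sub_apply, Pi.add_apply, if_true,
      if_false, or_true, or_false, and_true, and_false, or_self, and_self] <;> simp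

theorem projOp_empty : projOp R X ∅ = 0 := by
  ext f x
  exact partialComp_apply_of_notMem _ (by simp)

theorem shiftOp_mul_unshiftOp (hX : IsSubshift X) (α : List 𝒜) :
    shiftOp R X α * unshiftOp R X α = projOp R X (C X [] α) := by
  rw [shiftOp, unshiftOp, projOp, partialComp_mul]
  refine partialComp_congr (fun x => ⟨?_, ?_⟩) ?_
  · rintro ⟨⟨hx, y, rfl⟩, -⟩
    exact ⟨⟨_, hx⟩, ⟨y, rfl, hX.of_append_mem hx⟩, rfl⟩
  · rintro ⟨⟨_, hx⟩, ⟨y, rfl, hy⟩, rfl⟩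
    refine ⟨⟨hx, y, rfl⟩, ?_⟩
    rwa [Set.mem_preimage, Stream'.drop_append_stream]
  · rintro x ⟨⟨hx, y, rfl⟩, -⟩
    rw [Function.comp_apply, Stream'.drop_append_stream, id]

theorem unshiftOp_mul_shiftOp (hX : IsSubshift X) (α : List 𝒜) :
    unshiftOp R X α * shiftOp R X α = projOp R X (C X α []) := by
  rw [shiftOp, unshiftOp, projOp, partialComp_mul]
  refine partialComp_congr (fun x => ⟨?_, ?_⟩) ?_
  · rintro ⟨hx, -⟩
    exact ⟨⟨x, hX.of_append_mem hx⟩, ⟨x, rfl, hx⟩, rfl⟩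
  · rintro ⟨⟨_, hx⟩, ⟨y, rfl, hy⟩, rfl⟩
    exact ⟨hy, hy, _, rfl⟩
  · intro x _
    rw [Function.comp_apply, Stream'.drop_append_stream, id]

/-- The middle factor s_α^* s_α tests whether αy ∈ X; conjugating by s_β applies this test to the
tail y of βy. -/
theorem shiftOp_unshiftOp_shiftOp_unshiftOp (hX : IsSubshift X) (α β : List 𝒜) :
    shiftOp R X β * unshiftOp R X α * shiftOp R X α * unshiftOp R X β =
      projOp R X (C X α β) := by
  rw [mul_assoc (shiftOp R X β), unshiftOp_mul_shiftOp R hX, shiftOp, unshiftOp, projOp, projOp,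
    partialComp_mul, partialComp_mul]
  refine partialComp_congr (fun x => ⟨?_, ?_⟩) ?_
  · rintro ⟨⟨⟨hx, y, rfl⟩, ⟨⟨_, hz⟩, ⟨z, rfl, hz'⟩, h⟩⟩, -⟩
    rw [Stream'.drop_append_stream] at h
    subst h
    exact ⟨⟨_, hx⟩, ⟨_, rfl, hz'⟩, rfl⟩
  · rintro ⟨⟨_, hx⟩, ⟨y, rfl, hy⟩, rfl⟩
    refine ⟨⟨⟨hx, y, rfl⟩, ?_⟩, ?_⟩
    · rw [Set.mem_preimage, Stream'.drop_append_stream]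
      exact ⟨⟨y, hX.of_append_mem hx⟩, ⟨y, rfl, hy⟩, rfl⟩
    · rw [Set.mem_preimage, Function.comp_apply, Stream'.drop_append_stream]
      exact hx
  · rintro x ⟨⟨⟨hx, y, rfl⟩, -⟩, -⟩
    rw [Function.comp_apply, Function.comp_apply, Stream'.drop_append_stream, id, id]

theorem shiftOp_unshiftOp_shiftOp (hX : IsSubshift X) (α : List 𝒜) :
    shiftOp R X α * unshiftOp R X α * shiftOp R X α = shiftOp R X α := by
  rw [shiftOp_mul_unshiftOp R hX, projOp, shiftOp, partialComp_mul]
  refine partialComp_congr (fun x => ⟨fun h => h.2, ?_⟩) fun _ _ => rfl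
  rintro ⟨hx, y, rfl⟩
  exact ⟨⟨⟨_, hx⟩, ⟨y, rfl, hX.of_append_mem hx⟩, rfl⟩, hx, y, rfl⟩

theorem unshiftOp_shiftOp_unshiftOp (hX : IsSubshift X) (α : List 𝒜) :
    unshiftOp R X α * shiftOp R X α * unshiftOp R X α = unshiftOp R X α := by
  rw [unshiftOp_mul_shiftOp R hX, projOp, unshiftOp, partialComp_mul]
  refine partialComp_congr (fun x => ⟨fun h => h.2, fun hx => ⟨?_, hx⟩⟩) fun _ _ => rfl
  exact ⟨⟨x, hX.of_append_mem hx⟩, ⟨x, rfl, hx⟩, rfl⟩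

variable (X) in
/-- The operators representing the generators of the subshift algebra. -/
def genOp : Gen 𝒜 (B X) → Module.End R (Stream' 𝒜 → R) :=
  Gen.elim (fun A => projOp R X A.1) (fun a => shiftOp R X [a]) fun a => unshiftOp R X [a]

theorem lift_genOp_p (A : Set X) (hA : A ∈ B X) :
    NFree.lift (genOp R X) (BFree.p R A hA) = projOp R X A :=
  NFree.lift_ι _ _

theorem lift_genOp_s (a : 𝒜) : NFree.lift (genOp R X) (BFree.s R X a) = shiftOp R X [a] :=
  NFree.lift_ι _ _

theorem lift_genOp_t (a : 𝒜) : NFree.lift (genOp R X) (BFree.t R X a) = unshiftOp R X [a] :=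
  NFree.lift_ι _ _

theorem lift_genOp_sWord (hX : IsSubshift X) (a : 𝒜) (α : List 𝒜) :
    NFree.lift (genOp R X) (BFree.sWord R X a α) = shiftOp R X (a :: α) := by
  induction α generalizing a with
  | nil => exact lift_genOp_s R a
  | cons b α ih => rw [BFree.sWord, map_mul, ih, lift_genOp_s, shiftOp_append R hX]; rfl

theorem lift_genOp_tWord (hX : IsSubshift X) (a : 𝒜) (α : List 𝒜) :
    NFree.lift (genOp R X) (BFree.tWord R X a α) = unshiftOp R X (a :: α) := by
  induction α generalizing a with
  | nil => exact lift_genOp_t R a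
  | cons b α ih => rw [BFree.tWord, map_mul, ih, lift_genOp_t, unshiftOp_append R hX]; rfl

/-- The representation of the subshift algebra on the functions on sequences. -/
def representation (hX : IsSubshift X) :
    NonUnitalAlgebra R X →ₙₐ[R] Module.End R (Stream' 𝒜 → R) :=
  Presented.lift (NFree.lift (genOp R X)) (by
    intro x y h
    induction h with
    | inter P Q hP hQ => simp only [lift_genOp_p, map_mul, projOp_inter]
    | union P Q hP hQ => simp only [lift_genOp_p, map_sub, map_add, projOp_union]
    | empty => simp only [lift_genOp_p, map_zero, projOp_empty]
    | sts a => simp only [lift_genOp_s, lift_genOp_t, map_mul, shiftOp_unshiftOp_shiftOp R hX]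
    | tst a => simp only [lift_genOp_s, lift_genOp_t, map_mul, unshiftOp_shiftOp_unshiftOp R hX]
    | word a α b β hα hβ =>
      simp only [lift_genOp_sWord R hX, lift_genOp_tWord R hX, lift_genOp_p, map_mul,
        shiftOp_unshiftOp_shiftOp_unshiftOp R hX]
    | follower a α hα =>
      simp only [lift_genOp_sWord R hX, lift_genOp_tWord R hX, lift_genOp_p, map_mul,
        unshiftOp_mul_shiftOp R hX]
    | cylinder b β hβ =>
      simp only [lift_genOp_sWord R hX, lift_genOp_tWord R hX, lift_genOp_p, map_mul,
        shiftOp_mul_unshiftOp R hX])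

theorem representation_p (hX : IsSubshift X) (A : Set X) (hA : A ∈ B X) :
    representation R hX (proj R A hA) = projOp R X A :=
  lift_genOp_p R A hA

variable {R}

/-- The projections of the subshift algebra over a nontrivial ring determine the inclusions
between the sets. -/
theorem subset_of_proj_mul_eq [Nontrivial R] (hX : IsSubshift X) {P Q : Set X} (hP : P ∈ B X)
    (hQ : Q ∈ B X) (h : proj R P hP * proj R Q hQ = proj R P hP) : P ⊆ Q := by
  intro x hx
  have h' := congrArg (representation R hX) h
  rw [← proj_inter, representation_p, representation_p] at h'
  -- On the constant function 1 the operators return the indicators of P ∩ Q and P; if x ∈ P \ Q,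
  -- their values at x would be 0 and 1.
  have h₁ := congrFun (LinearMap.congr_fun h' fun _ => 1) x
  rw [projOp, projOp, partialComp_apply_of_mem (D := Subtype.val '' P) _ ⟨x, hx, rfl⟩] at h₁
  by_contra hxQ
  rw [partialComp_apply_of_notMem _ (by rintro ⟨y, hy, hyx⟩; exact hxQ (Subtype.ext hyx ▸ hy.2))]
    at h₁
  exact zero_ne_one h₁

/-- Over a nontrivial ring, the subshift algebra is unital only if `X ∈ 𝓑`. -/
theorem univ_mem_B_of_isUnital [Nontrivial R] (hX : IsSubshift X)
    (hletters : ∀ a : 𝒜, [a] ∈ language X) (h : IsUnital (NonUnitalAlgebra R X)) :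
    Set.univ ∈ B X := by
  obtain ⟨e, he⟩ := h
  obtain ⟨P, hP, h₁, -⟩ := exists_local_unit hletters e
  -- A projection that is a local unit for the identity equals it: p_P = p_P e = e.
  obtain rfl : proj R P hP = e := by rw [← (he (proj R P hP)).2, h₁]
  have huniv : P = Set.univ := by
    refine Set.eq_univ_of_forall fun x => ?_
    -- Each x lies in the cylinder of its first letter, and P contains that cylinder because p_P is
    -- the identity.
    have hc : C X [] [(x : Stream' 𝒜).head] ∈ B X :=
      C_mem_B (nil_mem_language (hletters (x : Stream' 𝒜).head)) (hletters _) (by simp)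
    have hx : Stream'.cons (x : Stream' 𝒜).head (x : Stream' 𝒜).tail = x := Stream'.eta _
    exact subset_of_proj_mul_eq hX hc hP (he _).2
      ⟨(x : Stream' 𝒜).tail, hx.symm, hX.of_cons_mem (a := (x : Stream' 𝒜).head) (hx ▸ x.2)⟩
  exact huniv ▸ hP

end Representation

end SubshiftAlgebra

end

theorem mainTheorem11 {R : Type*} [CommRing R] {𝒜 : Type*} [Nonempty 𝒜]
    (X : Set (Stream' 𝒜)) (hX : SubshiftAlgebra.IsSubshift X)
    (hletters : ∀ a : 𝒜, [a] ∈ SubshiftAlgebra.language X) :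
    (SubshiftAlgebra.IsUnital (SubshiftAlgebra.NonUnitalAlgebra R X) →
      ∃ φ : SubshiftAlgebra.NonUnitalAlgebra R X →ₙₐ[R] SubshiftAlgebra.UnitalAlgebra R X,
        Function.Bijective φ) ∧
    (¬ SubshiftAlgebra.IsUnital (SubshiftAlgebra.NonUnitalAlgebra R X) →
      Nonempty (Unitization R (SubshiftAlgebra.NonUnitalAlgebra R X) ≃ₐ[R]
        SubshiftAlgebra.UnitalAlgebra R X)) := by
  open SubshiftAlgebra in
  constructor
  · intro h
    refine ⟨toUnital R X, ?_⟩
    -- Over the zero ring both algebras vanish, and the detection of sets by projections, which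
    -- needs 0 ≠ 1, is unavailable.
    rcases subsingleton_or_nontrivial R with hR | hR
    · have := Module.subsingleton R (NonUnitalAlgebra R X)
      have := Module.subsingleton R (UnitalAlgebra R X)
      exact ⟨Function.injective_of_subsingleton _, fun y => ⟨0, Subsingleton.elim _ _⟩⟩
    have hu := univ_mem_B_of_isUnital hX hletters h
    obtain ⟨E, _, _, i, hi⟩ := h.exists_algebra R
    have h₁ : i (proj R Set.univ hu) = 1 := by
      -- With i(x) = 1, one gets i(p_X) = i(p_X) i(x) = i(p_X x) = i(x) = 1.
      obtain ⟨x, hx⟩ := hi.2 1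
      rw [← mul_one (i _), ← hx, ← map_mul, (proj_univ_mul hletters hu x).1]
    obtain ⟨ψ, hψ⟩ := exists_extension i fun _ => h₁
    constructor
    · intro x y hxy
      apply hi.1
      rw [← hψ, ← hψ, hxy]
    · intro y
      obtain ⟨x, rfl⟩ := lift_toUnital_surjective R X y
      have h₂ : toUnital R X (proj R Set.univ hu) = 1 :=
        (toUnital_p R X _ hu).trans ((UnitalAlgebra.mk_eq_of_rel URel.univ).trans (map_one _))
      induction x with
      | inl_add_inr r a =>
        -- The scalar r is hit by r p_X, since p_X maps to 1.
        refine ⟨r • proj R Set.univ hu + a, ?_⟩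
        rw [map_add, map_smul, h₂]
        simp [Algebra.algebraMap_eq_smul_one]
  · intro h
    have hu : Set.univ ∉ B X := fun hu => h ⟨_, proj_univ_mul hletters hu⟩
    obtain ⟨ψ, hψ⟩ := exists_extension (Unitization.inrNonUnitalAlgHom R (NonUnitalAlgebra R X))
      fun h' => absurd h' hu
    -- Unital homomorphisms out of a unitization are determined on the original algebra, where `hψ`
    -- applies.
    have hinv : ψ.comp (Unitization.lift (toUnital R X)) = AlgHom.id R _ :=
      Unitization.algHom_ext'' fun a => by simpa using hψ a
    refine ⟨AlgEquiv.ofBijective (Unitization.lift (toUnital R X)) ⟨?_, ?_⟩⟩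
    · exact Function.LeftInverse.injective (g := ψ) fun x => AlgHom.congr_fun hinv x
    · exact lift_toUnital_surjective R X
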